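/- Let $\mathcal{C}=\{0,1\}^{\mathbb N}$ be Cantor space with its product topology, let $\mathcal{P}$ be the set of Borel probability measures on $\mathcal{C}$ (called \emph{sources}), and for a finite binary string $w$ let $B_w\subset\mathcal{C}$ be the set of sequences beginning with $w$; write $\lambda(w)=\lambda(B_w)$ and $\lambda(A\mid w)=\lambda(A\cap B_w)/\lambda(B_w)$. For $\sigma\in\mathcal{C}$ let $\sigma[n]$ be the string of its first $n$ bits. A \emph{forecaster} is a $\mu\in\mathcal{P}$ of full support, i.e. one that gives positive measure to every nonempty open set. A forecaster $\mu$ \emph{strongly NC-learns} a source $\lambda$ if for $\lambda$-almost every $\sigma\in\mathcal{C}$ $$\lim_{n\to\infty}\ \sup_{A\subseteq\mathcal{C}\text{ Borel}}\bigl|\mu(A\mid\sigma[n])-\lambda(A\mid\sigma[n])\bigr|=0.$$ A source $\lambda$ is \emph{computable} if there is a computable $F:\{0,1\}^*\times\mathbb N\to\mathbb Q$ with $|\lambda(w)-F(w,n)|<2^{-n}$ for all $w$ and $n$. A sequence $(\lambda_k)_{k\ge 0}$ of sources is \emph{uniformly computable} if there is a computable $F:\mathbb N\times\{0,1\}^*\times\mathbb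 N\to\mathbb Q$ with $|\lambda_k(w)-F(k,w,n)|\le 2^{-n}$ for all $k$, $w$ and $n$. For a source $\mu$ and a sequence $(\lambda_k)_{k\ge0}$ of sources put $$\mu^*=\tfrac12\,\mu+\tfrac12\sum_{k=0}^{\infty}2^{-(k+1)}\lambda_k .$$ (a) Let $\mu$ be a forecaster and let $S$ be a countable (possibly finite or empty) set of sources. Then there is a forecaster that strongly NC-learns every source in $S$ and every source that $\mu$ strongly NC-learns. Moreover, if $(\lambda_k)_{k\ge0}$ is any enumeration of $S$ (repetitions allowed), then the mixture $\mu^*$ is such a forecaster. (b) Let $\mu$ be a computable forecaster and let $(\lambda_k)_{k\ge0}$ be a uniformly computable sequence of sources. Then $\mu^*$ is a computable forecaster, and it strongly NC-learns every $\lambda_k$ and every source that $\mu$ strongly NC-learns. -/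

import Mathlib

open MeasureTheory ProbabilityTheory Filter Topology

noncomputable section

namespace NextChance

/-- Cantor space with its product topology and product (= Borel) sigma-algebra; the first bit of
`σ` is `σ 0`. -/
abbrev Cantor : Type := ℕ → Bool

/-- A source is a Borel probability measure on Cantor space. -/
abbrev Source : Type := ProbabilityMeasure Cantor

/-- The string formed by the first `n` bits of `σ`. -/
def initSeg (σ : Cantor) (n : ℕ) : List Bool := (List.range n).map σ

/-- The basic open set of all sequences that begin with the string `w`. -/
def basicOpen (w : List Bool) : Set Cantor := {σ | initSeg σ w.length = w}

/-- The probability of `A` given that the data stream begins with `w`. -/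
def condProb (μ : Source) (A : Set Cantor) (w : List Bool) : ℝ :=
  (cond (μ : Measure Cantor) (basicOpen w)).real A

/-- A forecaster is a Borel probability measure of full support. -/
def IsForecaster (μ : Source) : Prop :=
  (μ : Measure Cantor).IsOpenPosMeasure

/-- For almost every data stream `σ` sampled from `ν`, the supremum over all Borel sets of the
difference between the conditional probabilities given the first `n` bits of `σ` tends to `0`. -/
def StronglyNCLearns (μ ν : Source) : Prop :=
  ∀ᵐ σ ∂(ν : Measure Cantor),
    Tendsto (fun n : ℕ => ⨆ A : {A : Set Cantor // MeasurableSet A},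
      |condProb μ A.1 (initSeg σ n) - condProb ν A.1 (initSeg σ n)|) atTop (𝓝 0)

/-- A rational-valued function is computable if it is given by a computable integer numerator and
a computable nonzero denominator (not necessarily in lowest terms). -/
def ComputableRat {α : Type} [Primcodable α] (f : α → ℚ) : Prop :=
  ∃ (a : α → ℤ) (b : α → ℕ), Computable a ∧ Computable b ∧
    ∀ x, b x ≠ 0 ∧ f x = (a x : ℚ) / (b x : ℚ)

/-- Computability of a Borel probability measure on Cantor space. -/
def IsComputableSource (μ : Source) : Prop :=
  ∃ F : List Bool × ℕ → ℚ, ComputableRat F ∧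
    ∀ (w : List Bool) (n : ℕ),
      |(μ : Measure Cantor).real (basicOpen w) - (F (w, n) : ℝ)| < (1 / 2 : ℝ) ^ n

/-- Uniform computability of a sequence of Borel probability measures on Cantor space. -/
def UniformlyComputable (s : ℕ → Source) : Prop :=
  ∃ F : ℕ × List Bool × ℕ → ℚ, ComputableRat F ∧
    ∀ (i : ℕ) (w : List Bool) (n : ℕ),
      |(s i : Measure Cantor).real (basicOpen w) - (F (i, w, n) : ℝ)| ≤ (1 / 2 : ℝ) ^ n

/-- A forecasting machine is a computable forecaster. -/
def IsForecastingMachine (μ : Source) : Prop :=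
  IsForecaster μ ∧ IsComputableSource μ

/-- The measure `½ μ + ½ ∑_{k ≥ 0} 2^{-(k+1)} s k`. -/
def mixtureMeasure (μ : Source) (s : ℕ → Source) : Measure Cantor :=
  (2⁻¹ : ENNReal) • (μ : Measure Cantor) +
    (2⁻¹ : ENNReal) • Measure.sum fun k => (2⁻¹ : ENNReal) ^ (k + 1) • (s k : Measure Cantor)

theorem isProbabilityMeasure_mixtureMeasure (μ : Source) (s : ℕ → Source) :
    IsProbabilityMeasure (mixtureMeasure μ s) := by
  constructor
  have h : (2⁻¹ : ENNReal) * 2 = 1 := ENNReal.inv_mul_cancel (by simp) (by simp)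
  simp [mixtureMeasure, ENNReal.tsum_geometric_add_one, h, ENNReal.inv_two_add_inv_two]

/-- The mixture `½ μ + ½ ∑_{k ≥ 0} 2^{-(k+1)} s k`, as a probability measure. -/
def mixture (μ : Source) (s : ℕ → Source) : Source :=
  ⟨mixtureMeasure μ s, isProbabilityMeasure_mixtureMeasure μ s⟩

end NextChance

end

/-! Strong NC-learning of `ν` by `μ` is equivalent to `ν ≪ μ`. If `μ E = 0`, the supremum is at
least `ν(E | σ[n])`, which tends to 1 for `ν`-almost every `σ ∈ E` by Lévy's law; learning thus
forces `ν E = 0` (`StronglyNCLearns.absolutelyContinuous`). The converse is Blackwell–Dubins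
(`stronglyNCLearns_of_absolutelyContinuous`): averages of the density over shrinking cylinders
converge to its value, which is positive `ν`-almost everywhere. The mixture dominates `μ` and every
component, so transitivity of `≪` gives all the learning claims, and full support passes up along
`≪`. It is computable because its series has a geometric tail and can be truncated. -/

namespace NextChance

/-! ### Primitive recursive integer arithmetic -/

theorem primrec_int_toNat : Primrec Int.toNat := by
  -- The parity of the code is the sign: `n` has code `2 * n` and `-(n + 1)` has code `2 * n + 1`.
  refine (Primrec.ite (c := fun z : ℤ => Encodable.encode z % 2 = 0)
    (Primrec.eq.comp (Primrec.nat_mod.comp Primrec.encode (Primrec.const 2)) (Primrec.const 0))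
    (Primrec.nat_div.comp Primrec.encode (Primrec.const 2)) (Primrec.const 0)).of_eq ?_
  rintro (n | n)
  · have : Encodable.encode (Int.ofNat n) = 2 * n := rfl
    rw [this]; simp
  · have : Encodable.encode (Int.negSucc n) = 2 * n + 1 := rfl
    rw [this]; simp

theorem primrec_int_neg_toNat : Primrec fun z : ℤ => (-z).toNat := by
  refine (Primrec.ite (c := fun z : ℤ => Encodable.encode z % 2 = 0)
    (Primrec.eq.comp (Primrec.nat_mod.comp Primrec.encode (Primrec.const 2)) (Primrec.const 0))
    (Primrec.const 0) (Primrec.succ.comp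
      (Primrec.nat_div.comp Primrec.encode (Primrec.const 2)))).of_eq ?_
  rintro (n | n)
  · have : Encodable.encode (Int.ofNat n) = 2 * n := rfl
    rw [this]; simp
  · have : Encodable.encode (Int.negSucc n) = 2 * n + 1 := rfl
    rw [this]
    have h : -Int.negSucc n = ((n + 1 : ℕ) : ℤ) := rfl
    rw [h, Int.toNat_natCast, if_neg (by omega)]
    omega

/-- Reduces integer arithmetic to `ℕ`: operate on positive and negative parts, then recombine by
`Int.subNatNat`. -/
theorem primrec₂_int_subNatNat : Primrec₂ Int.subNatNat := by
  have h1 : Primrec fun p : ℕ × ℕ => 2 * (p.1 - p.2) :=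
    Primrec.nat_mul.comp (Primrec.const 2) (Primrec.nat_sub.comp Primrec.fst Primrec.snd)
  have h2 : Primrec fun p : ℕ × ℕ => 2 * (p.2 - p.1 - 1) + 1 :=
    Primrec.succ.comp (Primrec.nat_mul.comp (Primrec.const 2) (Primrec.nat_sub.comp
      (Primrec.nat_sub.comp Primrec.snd Primrec.fst) (Primrec.const 1)))
  refine Primrec.encode_iff.1 ((Primrec.ite (c := fun p : ℕ × ℕ => p.2 ≤ p.1)
    (Primrec.nat_le.comp Primrec.snd Primrec.fst) h1 h2).of_eq ?_)
  rintro ⟨m, n⟩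
  by_cases h : n ≤ m
  · simp only [h, if_true, Int.subNatNat_of_le h]
    rfl
  · simp only [h, if_false]
    rw [Int.subNatNat_of_lt (not_le.1 h)]
    rfl

theorem primrec₂_int_add : Primrec₂ ((· + ·) : ℤ → ℤ → ℤ) := by
  refine (primrec₂_int_subNatNat.comp
    (Primrec.nat_add.comp (primrec_int_toNat.comp Primrec.fst)
      (primrec_int_toNat.comp Primrec.snd))
    (Primrec.nat_add.comp (primrec_int_neg_toNat.comp Primrec.fst)
      (primrec_int_neg_toNat.comp Primrec.snd))).of_eq ?_
  rintro ⟨x, y⟩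
  rw [Int.subNatNat_eq_coe]
  push_cast
  omega

theorem primrec₂_int_mul : Primrec₂ ((· * ·) : ℤ → ℤ → ℤ) := by
  have p₁ : Primrec fun p : ℤ × ℤ => p.1.toNat := primrec_int_toNat.comp Primrec.fst
  have p₂ : Primrec fun p : ℤ × ℤ => p.2.toNat := primrec_int_toNat.comp Primrec.snd
  have q₁ : Primrec fun p : ℤ × ℤ => (-p.1).toNat := primrec_int_neg_toNat.comp Primrec.fst
  have q₂ : Primrec fun p : ℤ × ℤ => (-p.2).toNat := primrec_int_neg_toNat.comp Primrec.snd
  refine (primrec₂_int_subNatNat.comp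
    (Primrec.nat_add.comp (Primrec.nat_mul.comp p₁ p₂) (Primrec.nat_mul.comp q₁ q₂))
    (Primrec.nat_add.comp (Primrec.nat_mul.comp p₁ q₂) (Primrec.nat_mul.comp q₁ p₂))).of_eq ?_
  rintro ⟨x, y⟩
  rw [Int.subNatNat_eq_coe]
  have hx := Int.toNat_sub_toNat_neg x
  have hy := Int.toNat_sub_toNat_neg y
  conv_rhs => rw [← hx, ← hy]
  push_cast
  ring

theorem primrec_int_ofNat : Primrec ((↑) : ℕ → ℤ) := by
  refine (primrec₂_int_subNatNat.comp Primrec.id (Primrec.const 0)).of_eq fun n => ?_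
  simp [Int.subNatNat_eq_coe]

/-! ### Computable rational-valued functions -/

namespace ComputableRat

variable {α β : Type} [Primcodable α] [Primcodable β]

theorem comp {f : β → ℚ} {g : α → β} (hf : ComputableRat f) (hg : Computable g) :
    ComputableRat fun x => f (g x) := by
  obtain ⟨a, b, ha, hb, h⟩ := hf
  exact ⟨_, _, ha.comp hg, hb.comp hg, fun x => h (g x)⟩

theorem add {f g : α → ℚ} (hf : ComputableRat f) (hg : ComputableRat g) :
    ComputableRat fun x => f x + g x := by
  obtain ⟨a, b, ha, hb, h⟩ := hf
  obtain ⟨c, d, hc, hd, h'⟩ := hg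
  refine ⟨fun x => a x * (d x : ℤ) + c x * (b x : ℤ), fun x => b x * d x,
    primrec₂_int_add.to_comp.comp
      (primrec₂_int_mul.to_comp.comp ha (primrec_int_ofNat.to_comp.comp hd))
      (primrec₂_int_mul.to_comp.comp hc (primrec_int_ofNat.to_comp.comp hb)),
    Primrec.nat_mul.to_comp.comp hb hd, fun x => ⟨mul_ne_zero (h x).1 (h' x).1, ?_⟩⟩
  have h₁ : (b x : ℚ) ≠ 0 := Nat.cast_ne_zero.2 (h x).1
  have h₂ : (d x : ℚ) ≠ 0 := Nat.cast_ne_zero.2 (h' x).1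
  dsimp only
  rw [(h x).2, (h' x).2, div_add_div _ _ h₁ h₂]
  push_cast
  ring

theorem mul {f g : α → ℚ} (hf : ComputableRat f) (hg : ComputableRat g) :
    ComputableRat fun x => f x * g x := by
  obtain ⟨a, b, ha, hb, h⟩ := hf
  obtain ⟨c, d, hc, hd, h'⟩ := hg
  refine ⟨fun x => a x * c x, fun x => b x * d x, primrec₂_int_mul.to_comp.comp ha hc,
    Primrec.nat_mul.to_comp.comp hb hd, fun x => ⟨mul_ne_zero (h x).1 (h' x).1, ?_⟩⟩
  dsimp only
  rw [(h x).2, (h' x).2, div_mul_div_comm]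
  push_cast
  rfl

theorem half_pow {e : α → ℕ} (he : Computable e) :
    ComputableRat fun x => (1 / 2 : ℚ) ^ e x := by
  have hpow : Primrec₂ ((· ^ ·) : ℕ → ℕ → ℕ) := Primrec₂.unpaired'.1 Nat.Primrec.pow
  refine ⟨fun _ => 1, fun x => 2 ^ e x, Computable.const 1,
    hpow.to_comp.comp (Computable.const 2) he, fun x => ⟨by positivity, ?_⟩⟩
  simp

theorem sum_range {f : α × ℕ → ℚ} {N : α → ℕ} (hf : ComputableRat f) (hN : Computable N) :
    ComputableRat fun x => ∑ k ∈ Finset.range (N x), f (x, k) := by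
  obtain ⟨a, b, ha, hb, h⟩ := hf
  -- The recursion carries the partial sum as an unreduced fraction, starting from `0 / 1`.
  let step : α → ℕ × (ℤ × ℕ) → ℤ × ℕ := fun x p =>
    (p.2.1 * (b (x, p.1) : ℤ) + a (x, p.1) * (p.2.2 : ℤ), p.2.2 * b (x, p.1))
  let R : α → ℕ → ℤ × ℕ := fun x n => Nat.rec (0, 1) (fun y IH => step x (y, IH)) n
  have hxk : Computable fun p : α × (ℕ × (ℤ × ℕ)) => (p.1, p.2.1) :=
    Computable.fst.pair (Computable.fst.comp Computable.snd)
  have hz : Computable fun p : α × (ℕ × (ℤ × ℕ)) => p.2.2.1 :=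
    Computable.fst.comp (Computable.snd.comp Computable.snd)
  have hd : Computable fun p : α × (ℕ × (ℤ × ℕ)) => p.2.2.2 :=
    Computable.snd.comp (Computable.snd.comp Computable.snd)
  have hstep : Computable₂ step :=
    (primrec₂_int_add.to_comp.comp
      (primrec₂_int_mul.to_comp.comp hz (primrec_int_ofNat.to_comp.comp (hb.comp hxk)))
      (primrec₂_int_mul.to_comp.comp (ha.comp hxk) (primrec_int_ofNat.to_comp.comp hd))).pair
    (Primrec.nat_mul.to_comp.comp hd (hb.comp hxk))
  have hR : Computable fun x => R x (N x) :=
    Computable.nat_rec hN (Computable.const (0, 1)) hstep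
  have key : ∀ x n, (R x n).2 ≠ 0 ∧
      ∑ k ∈ Finset.range n, f (x, k) = ((R x n).1 : ℚ) / ((R x n).2 : ℚ) := by
    intro x n
    induction n with
    | zero => simp [R]
    | succ n ih =>
      have hs : R x (n + 1) = ((R x n).1 * (b (x, n) : ℤ) + a (x, n) * ((R x n).2 : ℤ),
        (R x n).2 * b (x, n)) := rfl
      have h₁ : (b (x, n) : ℚ) ≠ 0 := Nat.cast_ne_zero.2 (h _).1
      have h₂ : ((R x n).2 : ℚ) ≠ 0 := Nat.cast_ne_zero.2 ih.1
      rw [hs, Finset.sum_range_succ, ih.2, (h _).2, div_add_div _ _ h₂ h₁]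
      refine ⟨mul_ne_zero ih.1 (h _).1, ?_⟩
      push_cast
      ring
  exact ⟨fun x => (R x (N x)).1, fun x => (R x (N x)).2, Computable.fst.comp hR,
    Computable.snd.comp hR, fun x => key x (N x)⟩

end ComputableRat

/-! ### Cylinders and Lévy's zero-one law -/

theorem measurable_initSeg (n : ℕ) : Measurable[_, ⊤] fun σ : Cantor => initSeg σ n := by
  have : (fun σ : Cantor => initSeg σ n) =
      (fun v : Fin n → Bool => List.ofFn v) ∘ fun σ i => σ i := by
    ext1 σ
    simp [initSeg, List.ofFn_eq_map, ← List.map_coe_finRange_eq_range]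
  have hv : Measurable fun (σ : Cantor) (i : Fin n) => σ i := by fun_prop
  intro t _
  rw [this, Set.preimage_comp]
  exact hv MeasurableSet.of_discrete

theorem measurableSet_basicOpen (w : List Bool) : MeasurableSet (basicOpen w) :=
  @measurable_initSeg w.length {w} trivial

theorem mem_basicOpen_initSeg {σ τ : Cantor} {n : ℕ} :
    τ ∈ basicOpen (initSeg σ n) ↔ initSeg τ n = initSeg σ n := by
  simp [basicOpen, initSeg]

/-- The filtration generated by the initial segments of the data stream. -/
def initSegFiltration : Filtration ℕ (inferInstance : MeasurableSpace Cantor) where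
  seq n := MeasurableSpace.comap (fun σ => initSeg σ n) ⊤
  mono' := by
    intro m n hmn
    have : (fun σ : Cantor => initSeg σ m) = List.take m ∘ fun σ => initSeg σ n := by
      ext1 σ
      simp [initSeg, ← List.map_take, List.take_range, hmn]
    dsimp only
    rw [this, ← MeasurableSpace.comap_comp]
    exact MeasurableSpace.comap_mono le_top
  le' n := (measurable_initSeg n).comap_le

theorem iSup_initSegFiltration :
    ⨆ n, initSegFiltration n = (inferInstance : MeasurableSpace Cantor) := by
  refine le_antisymm (iSup_le initSegFiltration.le) ?_
  refine iSup_le fun i => ?_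
  have : (fun σ : Cantor => σ i) = (fun l : List Bool => l.getD i false) ∘
      fun σ => initSeg σ (i + 1) := by
    ext1 σ
    simp [initSeg]
  refine le_trans ?_ (le_iSup (fun n => initSegFiltration n) (i + 1))
  change MeasurableSpace.comap (fun σ : Cantor => σ i) _ ≤
    MeasurableSpace.comap (fun σ => initSeg σ (i + 1)) ⊤
  rw [this, ← MeasurableSpace.comap_comp]
  exact MeasurableSpace.comap_mono le_top

/-- The conditional expectation factors through `initSeg`, so it is constant on each cylinder. The
product form also covers null cylinders. -/
theorem condExp_initSegFiltration_mul (ρ : Source) {f : Cantor → ℝ}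
    (hf : Integrable f (ρ : Measure Cantor)) (n : ℕ) (σ : Cantor) :
    ((ρ : Measure Cantor)[f | initSegFiltration n]) σ *
      (ρ : Measure Cantor).real (basicOpen (initSeg σ n)) =
    ∫ τ in basicOpen (initSeg σ n), f τ ∂(ρ : Measure Cantor) := by
  have hB : MeasurableSet[initSegFiltration n] (basicOpen (initSeg σ n)) :=
    ⟨{initSeg σ n}, trivial, by ext τ; simp [mem_basicOpen_initSeg]⟩
  have hfac : Function.FactorsThrough ((ρ : Measure Cantor)[f | initSegFiltration n])
      fun σ => initSeg σ n :=
    StronglyMeasurable.factorsThrough (mY := ⊤)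
      (f := fun σ : Cantor => initSeg σ n) stronglyMeasurable_condExp
  rw [← setIntegral_condExp (initSegFiltration.le n) hf hB,
    setIntegral_congr_fun (g := fun _ => ((ρ : Measure Cantor)[f | initSegFiltration n]) σ)
      (measurableSet_basicOpen _) fun τ hτ => hfac (mem_basicOpen_initSeg.1 hτ)]
  simp [mul_comm]

/-- **Lévy's zero-one law** in Lebesgue-differentiation form. -/
theorem ae_tendsto_average (ρ : Source) {f : Cantor → ℝ}
    (hf : Integrable f (ρ : Measure Cantor)) :
    ∀ᵐ σ ∂(ρ : Measure Cantor), Tendsto (fun n =>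
      (∫ τ in basicOpen (initSeg σ n), f τ ∂(ρ : Measure Cantor)) /
        (ρ : Measure Cantor).real (basicOpen (initSeg σ n))) atTop (𝓝 (f σ)) := by
  -- There are countably many strings, so the null cylinders together form a null set.
  have hpos : ∀ᵐ σ ∂(ρ : Measure Cantor), ∀ n,
      (ρ : Measure Cantor).real (basicOpen (initSeg σ n)) ≠ 0 := by
    have h : ∀ᵐ σ ∂(ρ : Measure Cantor), ∀ w : List Bool,
        σ ∈ basicOpen w → (ρ : Measure Cantor).real (basicOpen w) ≠ 0 := by
      refine ae_all_iff.2 fun w => ?_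
      by_cases hw : (ρ : Measure Cantor) (basicOpen w) = 0
      · filter_upwards [measure_eq_zero_iff_ae_notMem.1 hw] with σ hσ h
        exact absurd h hσ
      · exact Eventually.of_forall fun _ _ => by
          rwa [ne_eq, measureReal_eq_zero_iff]
    filter_upwards [h] with σ hσ n
    exact hσ _ (mem_basicOpen_initSeg.2 rfl)
  have hlim := tendsto_ae_condExp (μ := (ρ : Measure Cantor)) (ℱ := initSegFiltration) f
  have hid : (ρ : Measure Cantor)[f | ⨆ n, initSegFiltration n] =ᵐ[(ρ : Measure Cantor)] f := by
    rw [iSup_initSegFiltration]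
    exact condExp_of_aestronglyMeasurable' le_rfl hf.1 hf
  filter_upwards [hlim, hid, hpos] with σ h₁ h₂ h₃
  rw [h₂] at h₁
  refine h₁.congr fun n => ?_
  rw [← condExp_initSegFiltration_mul ρ hf, mul_div_cancel_right₀ _ (h₃ n)]

/-! ### Learning implies absolute continuity -/

theorem condProb_eq (ν : Source) (A : Set Cantor) (w : List Bool) :
    condProb ν A w = (ν : Measure Cantor).real (basicOpen w ∩ A) /
      (ν : Measure Cantor).real (basicOpen w) := by
  rw [condProb, Measure.real, cond_apply (measurableSet_basicOpen w), ENNReal.toReal_mul,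
    ENNReal.toReal_inv, ← div_eq_inv_mul]
  rfl

theorem bddAbove_abs_condProb_sub (μ ν : Source) (w : List Bool) :
    BddAbove (Set.range fun A : {A : Set Cantor // MeasurableSet A} =>
      |condProb μ A.1 w - condProb ν A.1 w|) := by
  refine ⟨1, ?_⟩
  rintro _ ⟨A, rfl⟩
  have h : ∀ κ : Source, 0 ≤ condProb κ A.1 w ∧ condProb κ A.1 w ≤ 1 := fun κ => by
    rw [condProb_eq]
    exact ⟨by positivity, div_le_one_of_le₀ (measureReal_mono Set.inter_subset_left)
      measureReal_nonneg⟩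
  exact abs_sub_le_of_nonneg_of_le (h μ).1 (h μ).2 (h ν).1 (h ν).2

theorem StronglyNCLearns.absolutelyContinuous {μ ν : Source} (h : StronglyNCLearns μ ν) :
    (ν : Measure Cantor) ≪ (μ : Measure Cantor) := by
  refine Measure.AbsolutelyContinuous.mk fun E hE hμE => ?_
  have hint : Integrable (E.indicator fun _ => (1 : ℝ)) (ν : Measure Cantor) :=
    (integrable_const 1).indicator hE
  rw [measure_eq_zero_iff_ae_notMem]
  filter_upwards [h, ae_tendsto_average ν hint] with σ h₁ h₂ hσ
  rw [Set.indicator_of_mem hσ] at h₂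
  have hle : ∀ n, (∫ τ in basicOpen (initSeg σ n), E.indicator (fun _ => (1 : ℝ)) τ
      ∂(ν : Measure Cantor)) / (ν : Measure Cantor).real (basicOpen (initSeg σ n)) ≤
      ⨆ A : {A : Set Cantor // MeasurableSet A},
        |condProb μ A.1 (initSeg σ n) - condProb ν A.1 (initSeg σ n)| := fun n => by
    refine le_trans (le_of_eq ?_) (le_ciSup (bddAbove_abs_condProb_sub μ ν _) ⟨E, hE⟩)
    have hμ : (μ : Measure Cantor).real (basicOpen (initSeg σ n) ∩ E) = 0 :=
      (measureReal_eq_zero_iff (measure_ne_top _ _)).2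
        (measure_mono_null Set.inter_subset_right hμE)
    rw [condProb_eq, condProb_eq, hμ, zero_div, zero_sub, abs_neg,
      abs_of_nonneg (div_nonneg measureReal_nonneg measureReal_nonneg),
      setIntegral_indicator hE]
    simp
  exact not_le.2 one_pos (le_of_tendsto_of_tendsto' h₂ h₁ hle)

/-! ### Absolute continuity implies learning -/

theorem abs_condProb_sub_le {ρ ν : Source} (hac : (ν : Measure Cantor) ≪ (ρ : Measure Cantor))
    {w : List Bool} (hw : 0 < (ν : Measure Cantor).real (basicOpen w)) (A : Set Cantor)
    (q : ℝ) :
    |condProb ρ A w - condProb ν A w| ≤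
      ((∫ τ in basicOpen w,
          |((ν : Measure Cantor).rnDeriv (ρ : Measure Cantor) τ).toReal - q|
            ∂(ρ : Measure Cantor)) / (ρ : Measure Cantor).real (basicOpen w) +
        |q - (∫ τ in basicOpen w,
          ((ν : Measure Cantor).rnDeriv (ρ : Measure Cantor) τ).toReal ∂(ρ : Measure Cantor)) /
            (ρ : Measure Cantor).real (basicOpen w)|) /
      ((∫ τ in basicOpen w,
          ((ν : Measure Cantor).rnDeriv (ρ : Measure Cantor) τ).toReal ∂(ρ : Measure Cantor)) /
            (ρ : Measure Cantor).real (basicOpen w)) := by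
  set f : Cantor → ℝ := fun τ => ((ν : Measure Cantor).rnDeriv (ρ : Measure Cantor) τ).toReal
  have hf : Integrable f (ρ : Measure Cantor) := Measure.integrable_toReal_rnDeriv
  have hr : 0 < (ρ : Measure Cantor).real (basicOpen w) := by
    refine measureReal_nonneg.lt_of_ne' fun h => hw.ne' ?_
    rw [measureReal_eq_zero_iff] at h ⊢
    exact hac h
  have hB := measurableSet_basicOpen w
  rw [condProb_eq, condProb_eq, ← Measure.setIntegral_toReal_rnDeriv hac (basicOpen w ∩ A),
    ← Measure.setIntegral_toReal_rnDeriv hac (basicOpen w)]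
  rw [← Measure.setIntegral_toReal_rnDeriv hac (basicOpen w)] at hw
  change 0 < ∫ τ in basicOpen w, f τ ∂(ρ : Measure Cantor) at hw
  change |_ - (∫ τ in basicOpen w ∩ A, f τ ∂(ρ : Measure Cantor)) /
    (∫ τ in basicOpen w, f τ ∂(ρ : Measure Cantor))| ≤ _
  set m := ∫ τ in basicOpen w, f τ ∂(ρ : Measure Cantor)
  set r := (ρ : Measure Cantor).real (basicOpen w)
  -- The mean `m / r` varies with `w`, while Lévy's law needs a fixed integrand; hence the detour
  -- through the constant `q`. Enlarging the domain to the whole cylinder then removes `A` from the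
  -- bound.
  have e₁ : (ρ : Measure Cantor).real (basicOpen w ∩ A) / r -
      (∫ τ in basicOpen w ∩ A, f τ ∂(ρ : Measure Cantor)) / m =
      (∫ τ in basicOpen w ∩ A, (m / r - f τ) ∂(ρ : Measure Cantor)) / m := by
    rw [integral_sub (integrable_const _) hf.integrableOn]
    simp
    field_simp
  have hq : Integrable (fun τ => |f τ - q|) (ρ : Measure Cantor) :=
    (hf.sub (integrable_const q)).abs
  have hd : Integrable (fun τ => |f τ - q| + |q - m / r|) (ρ : Measure Cantor) :=
    hq.add (integrable_const _)
  have e₂ : |∫ τ in basicOpen w ∩ A, (m / r - f τ) ∂(ρ : Measure Cantor)| ≤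
      ∫ τ in basicOpen w, (|f τ - q| + |q - m / r|) ∂(ρ : Measure Cantor) := by
    have hd' : Integrable (fun τ => |m / r - f τ|) (ρ : Measure Cantor) :=
      ((integrable_const _).sub hf).abs
    refine abs_integral_le_integral_abs.trans ((integral_mono hd'.integrableOn
      hd.integrableOn fun τ => ?_).trans
      (setIntegral_mono_set hd.integrableOn (Eventually.of_forall fun τ => by positivity)
        (LE.le.eventuallyLE Set.inter_subset_left)))
    dsimp only
    rw [abs_sub_comm (m / r)]
    exact abs_sub_le (f τ) q (m / r)
  rw [integral_add hq.integrableOn (integrable_const _)] at e₂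
  rw [e₁, abs_div, abs_of_pos hw]
  refine (div_le_div_of_nonneg_right e₂ hw.le).trans_eq ?_
  simp
  change (_ + r * _) / _ = _
  field_simp
  rfl

theorem ae_toReal_rnDeriv_pos {Ω : Type*} [MeasurableSpace Ω] {μ ν : Measure Ω}
    [SigmaFinite μ] [SigmaFinite ν] (h : ν ≪ μ) : ∀ᵐ ω ∂ν, 0 < (ν.rnDeriv μ ω).toReal := by
  filter_upwards [Measure.rnDeriv_pos h, h.ae_le (Measure.rnDeriv_lt_top ν μ)] with ω h₁ h₂
  exact ENNReal.toReal_pos h₁.ne' h₂.ne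

/-- The **Blackwell–Dubins theorem** on merging of opinions. -/
theorem stronglyNCLearns_of_absolutelyContinuous {ρ ν : Source}
    (hac : (ν : Measure Cantor) ≪ (ρ : Measure Cantor)) : StronglyNCLearns ρ ν := by
  set f : Cantor → ℝ := fun τ => ((ν : Measure Cantor).rnDeriv (ρ : Measure Cantor) τ).toReal
    with hfdef
  have hf : Integrable f (ρ : Measure Cantor) := Measure.integrable_toReal_rnDeriv
  have h₁ := hac.ae_le (ae_tendsto_average ρ hf)
  -- Rational `q` keep the exceptional set null, so `q` may later depend on `σ`.
  have h₂ : ∀ᵐ σ ∂(ν : Measure Cantor), ∀ q : ℚ, Tendsto (fun n =>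
      (∫ τ in basicOpen (initSeg σ n), |f τ - q| ∂(ρ : Measure Cantor)) /
        (ρ : Measure Cantor).real (basicOpen (initSeg σ n))) atTop (𝓝 |f σ - q|) :=
    ae_all_iff.2 fun q => hac.ae_le (ae_tendsto_average ρ (f := fun τ => |f τ - q|)
      (hf.sub (integrable_const _)).abs)
  have h₃ : ∀ᵐ σ ∂(ν : Measure Cantor), 0 < f σ :=
    ae_toReal_rnDeriv_pos hac
  filter_upwards [h₁, h₂, h₃] with σ h₁ h₂ h₃
  refine Metric.tendsto_nhds.2 fun ε hε => ?_
  -- The bound tends to `2 * |f σ - q| / f σ`, which this `q` makes less than `ε / 2`; the extra `ε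
  -- / 4` is slack for large `n`.
  obtain ⟨q, hq₁, hq₂⟩ := exists_rat_btwn
    (show f σ < f σ + ε * f σ / 4 from lt_add_of_pos_right _ (by positivity))
  have hlt : (|f σ - q| + |(q : ℝ) - f σ|) / f σ < ε / 2 + ε / 4 := by
    rw [div_lt_iff₀ h₃, abs_sub_comm, abs_of_pos (sub_pos.2 hq₁)]
    nlinarith [mul_pos hε h₃]
  have hlim := (((h₂ q).add ((tendsto_const_nhds (x := (q : ℝ))).sub h₁).abs).div h₁
    h₃.ne').eventually_lt_const hlt
  filter_upwards [hlim, h₁.eventually_const_lt h₃] with n hn hn'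
  have hw : 0 < (ν : Measure Cantor).real (basicOpen (initSeg σ n)) := by
    rw [← Measure.setIntegral_toReal_rnDeriv hac]
    by_contra hcon
    exact absurd hn' (not_lt.2 (div_nonpos_of_nonpos_of_nonneg (not_lt.1 hcon)
      measureReal_nonneg))
  have hA : ∀ A, |condProb ρ A (initSeg σ n) - condProb ν A (initSeg σ n)| ≤ ε / 2 + ε / 4 :=
    fun A => (abs_condProb_sub_le hac hw A q).trans hn.le
  have hsup : (⨆ A : {A : Set Cantor // MeasurableSet A},
      |condProb ρ A.1 (initSeg σ n) - condProb ν A.1 (initSeg σ n)|) ≤ ε / 2 + ε / 4 :=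
    Real.iSup_le (fun A => hA A.1) (by positivity)
  rw [Real.dist_0_eq_abs, abs_of_nonneg (Real.iSup_nonneg fun A => abs_nonneg _)]
  linarith

/-! ### The mixture dominates its components -/

theorem coe_mixture (μ : Source) (s : ℕ → Source) :
    (mixture μ s : Measure Cantor) = mixtureMeasure μ s := rfl

theorem absolutelyContinuous_mixture (μ : Source) (s : ℕ → Source) :
    (μ : Measure Cantor) ≪ (mixture μ s : Measure Cantor) := by
  rw [coe_mixture, mixtureMeasure]
  exact ((Measure.absolutelyContinuous_smul (by simp)).add_right _)

theorem component_absolutelyContinuous_mixture (μ : Source) (s : ℕ → Source) (k : ℕ) :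
    (s k : Measure Cantor) ≪ (mixture μ s : Measure Cantor) := by
  rw [coe_mixture, mixtureMeasure, add_comm]
  refine Measure.AbsolutelyContinuous.add_right ?_ _
  refine Measure.AbsolutelyContinuous.trans ?_ (Measure.absolutelyContinuous_smul (by simp))
  refine Measure.absolutelyContinuous_sum_right k (Measure.absolutelyContinuous_smul ?_)
  exact pow_ne_zero _ (by simp)

theorem IsForecaster.mixture {μ : Source} (hμ : IsForecaster μ) (s : ℕ → Source) :
    IsForecaster (mixture μ s) :=
  haveI : (μ : Measure Cantor).IsOpenPosMeasure := hμ
  (absolutelyContinuous_mixture μ s).isOpenPosMeasure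

theorem stronglyNCLearns_mixture (μ : Source) (s : ℕ → Source) (k : ℕ) :
    StronglyNCLearns (mixture μ s) (s k) :=
  stronglyNCLearns_of_absolutelyContinuous (component_absolutelyContinuous_mixture μ s k)

theorem StronglyNCLearns.mixture {μ ν : Source} (h : StronglyNCLearns μ ν) (s : ℕ → Source) :
    StronglyNCLearns (mixture μ s) ν :=
  stronglyNCLearns_of_absolutelyContinuous
    (h.absolutelyContinuous.trans (absolutelyContinuous_mixture μ s))

/-! ### Computability of the mixture -/

theorem hasSum_mixture_real (μ : Source) (s : ℕ → Source) {A : Set Cantor}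
    (hA : MeasurableSet A) :
    HasSum (fun k => (1 / 2 : ℝ) ^ (k + 1) * (s k : Measure Cantor).real A)
      (2 * (mixture μ s : Measure Cantor).real A - (μ : Measure Cantor).real A) := by
  have hne : ∀ k, (2⁻¹ : ENNReal) ^ (k + 1) * (s k : Measure Cantor) A ≠ ⊤ := fun k =>
    ENNReal.mul_ne_top (ENNReal.pow_ne_top (by simp)) (measure_ne_top _ _)
  have hsum : ∑' k, (2⁻¹ : ENNReal) ^ (k + 1) * (s k : Measure Cantor) A ≠ ⊤ := by
    refine ne_top_of_le_ne_top ENNReal.one_ne_top ?_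
    calc _ ≤ ∑' k, (2⁻¹ : ENNReal) ^ (k + 1) :=
          ENNReal.tsum_le_tsum fun k => mul_le_of_le_one_right' prob_le_one
      _ ≤ 1 := by simp [ENNReal.tsum_geometric_add_one, ENNReal.inv_mul_cancel]
  have h := ENNReal.hasSum_toReal hsum
  rw [← ENNReal.tsum_toReal_eq hne] at h
  convert h using 1
  · ext k
    simp [Measure.real]
  · have : (mixture μ s : Measure Cantor) A = 2⁻¹ * (μ : Measure Cantor) A +
        2⁻¹ * ∑' k, (2⁻¹ : ENNReal) ^ (k + 1) * (s k : Measure Cantor) A := by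
      rw [coe_mixture, mixtureMeasure]
      simp [Measure.sum_apply _ hA]
    rw [Measure.real, this, ENNReal.toReal_add
      (ENNReal.mul_ne_top (by simp) (measure_ne_top _ _)) (ENNReal.mul_ne_top (by simp) hsum)]
    simp [Measure.real]
    ring

theorem abs_sub_sum_range_le_half_pow {a : ℕ → ℝ} {S : ℝ} (h : HasSum a S) (h₀ : ∀ k, 0 ≤ a k)
    (h₁ : ∀ k, a k ≤ (1 / 2) ^ (k + 1)) (N : ℕ) :
    |S - ∑ k ∈ Finset.range N, a k| ≤ (1 / 2) ^ N := by
  have ht := (hasSum_nat_add_iff' N).2 h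
  rw [abs_of_nonneg (ht.nonneg fun k => h₀ _)]
  refine hasSum_le (fun k => ?_) ht (hasSum_geometric_two' ((1 / 2 : ℝ) ^ N))
  refine (h₁ _).trans_eq ?_
  rw [pow_succ, pow_add]
  simp
  ring

/-- The weights sum to at most 1, so a uniform error is not amplified, however many terms are kept.
-/
theorem abs_sum_half_pow_mul_sub_le {x y : ℕ → ℝ} {δ : ℝ} (h : ∀ k, |x k - y k| ≤ δ) (N : ℕ) :
    |∑ k ∈ Finset.range N, (1 / 2 : ℝ) ^ (k + 1) * x k -
      ∑ k ∈ Finset.range N, (1 / 2 : ℝ) ^ (k + 1) * y k| ≤ δ := by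
  have hδ : 0 ≤ δ := (abs_nonneg _).trans (h 0)
  have hs : HasSum (fun k : ℕ => (1 / 2 : ℝ) ^ (k + 1)) 1 := by
    refine (hasSum_geometric_two' (1 : ℝ)).congr_fun fun k => ?_
    rw [pow_succ]
    simp
    ring
  rw [← Finset.sum_sub_distrib]
  calc |∑ k ∈ Finset.range N, ((1 / 2 : ℝ) ^ (k + 1) * x k - (1 / 2 : ℝ) ^ (k + 1) * y k)|
      ≤ ∑ k ∈ Finset.range N, (1 / 2 : ℝ) ^ (k + 1) * δ := by
        refine (Finset.abs_sum_le_sum_abs _ _).trans (Finset.sum_le_sum fun k _ => ?_)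
        rw [← mul_sub, abs_mul, abs_of_pos (by positivity)]
        exact mul_le_mul_of_nonneg_left (h k) (by positivity)
    _ = (∑ k ∈ Finset.range N, (1 / 2 : ℝ) ^ (k + 1)) * δ := (Finset.sum_mul _ _ _).symm
    _ ≤ 1 * δ := mul_le_mul_of_nonneg_right
        (sum_le_hasSum _ (fun k _ => by positivity) hs) hδ
    _ = δ := one_mul δ

theorem IsComputableSource.mixture {μ : Source} (hμ : IsComputableSource μ) {s : ℕ → Source}
    (hs : UniformlyComputable s) : IsComputableSource (mixture μ s) := by
  obtain ⟨F, hF, hFμ⟩ := hμ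
  obtain ⟨G, hG, hGs⟩ := hs
  -- `n + 2` is both the precision and the number of terms: three errors of at most `2^{-(n+2)}`,
  -- halved, total at most `(3/8) * 2^{-n}`.
  have hn : Computable fun x : List Bool × ℕ => x.2 + 2 :=
    Computable.succ.comp (Computable.succ.comp Computable.snd)
  have hterm : ComputableRat fun p : (List Bool × ℕ) × ℕ =>
      (1 / 2 : ℚ) ^ (p.2 + 1) * G (p.2, p.1.1, p.1.2 + 2) :=
    (ComputableRat.half_pow (Computable.succ.comp Computable.snd)).mul
      (hG.comp (Computable.snd.pair ((Computable.fst.comp Computable.fst).pair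
        (hn.comp Computable.fst))))
  have hhalf : ComputableRat fun _ : List Bool × ℕ => (1 / 2 : ℚ) ^ 1 :=
    ComputableRat.half_pow (Computable.const 1)
  refine ⟨_, hhalf.mul ((hF.comp (Computable.fst.pair hn)).add (hterm.sum_range hn)),
    fun w n => ?_⟩
  have hB := measurableSet_basicOpen w
  have h₁ := hFμ w (n + 2)
  have h₂ := abs_sum_half_pow_mul_sub_le (fun k => hGs k w (n + 2)) (n + 2)
  have h₃ := abs_sub_sum_range_le_half_pow (hasSum_mixture_real μ s hB)
    (fun k => by positivity)
    (fun k => mul_le_of_le_one_right (by positivity) measureReal_le_one) (n + 2)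
  have h₄ : (0 : ℝ) < (1 / 2) ^ n := by positivity
  push_cast
  rw [pow_add] at h₁ h₂ h₃
  rw [abs_lt] at h₁ ⊢
  rw [abs_le] at h₂ h₃
  constructor <;> linarith [h₁.1, h₁.2, h₂.1, h₂.2, h₃.1, h₃.2]

end NextChance

theorem mainTheorem11 :
    (∀ μ : NextChance.Source, NextChance.IsForecaster μ →
      ∀ S : Set NextChance.Source, S.Countable →
        (∃ μ' : NextChance.Source, NextChance.IsForecaster μ' ∧
          (∀ ν ∈ S, NextChance.StronglyNCLearns μ' ν) ∧
          (∀ ν : NextChance.Source, NextChance.StronglyNCLearns μ ν →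
            NextChance.StronglyNCLearns μ' ν)) ∧
        (∀ s : ℕ → NextChance.Source, Set.range s = S →
          NextChance.IsForecaster (NextChance.mixture μ s) ∧
          (∀ ν ∈ S, NextChance.StronglyNCLearns (NextChance.mixture μ s) ν) ∧
          (∀ ν : NextChance.Source, NextChance.StronglyNCLearns μ ν →
            NextChance.StronglyNCLearns (NextChance.mixture μ s) ν))) ∧
    (∀ μ : NextChance.Source, NextChance.IsForecastingMachine μ →
      ∀ s : ℕ → NextChance.Source, NextChance.UniformlyComputable s →
        NextChance.IsForecastingMachine (NextChance.mixture μ s) ∧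
        (∀ k : ℕ, NextChance.StronglyNCLearns (NextChance.mixture μ s) (s k)) ∧
        (∀ ν : NextChance.Source, NextChance.StronglyNCLearns μ ν →
          NextChance.StronglyNCLearns (NextChance.mixture μ s) ν)) := by
  refine ⟨fun μ hμ S hS => ?_, fun μ hμ s hs => ⟨⟨hμ.1.mixture s, hμ.2.mixture hs⟩,
    NextChance.stronglyNCLearns_mixture μ s, fun ν hν => hν.mixture s⟩⟩
  have hmix : ∀ s : ℕ → NextChance.Source, Set.range s = S →
      NextChance.IsForecaster (NextChance.mixture μ s) ∧
      (∀ ν ∈ S, NextChance.StronglyNCLearns (NextChance.mixture μ s) ν) ∧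
      (∀ ν : NextChance.Source, NextChance.StronglyNCLearns μ ν →
        NextChance.StronglyNCLearns (NextChance.mixture μ s) ν) := by
    rintro s rfl
    refine ⟨hμ.mixture s, ?_, fun ν hν => hν.mixture s⟩
    rintro _ ⟨k, rfl⟩
    exact NextChance.stronglyNCLearns_mixture μ s k
  refine ⟨?_, hmix⟩
  rcases S.eq_empty_or_nonempty with rfl | hne
  -- An empty `S` has no enumeration by `ℕ`; `μ` itself serves.
  · exact ⟨μ, hμ, fun ν hν => hν.elim, fun ν hν => hν⟩
  · obtain ⟨s, hs⟩ := hS.exists_eq_range hne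
    exact ⟨_, hmix s hs.symm⟩
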